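/- Let $A_1,\dots,A_n$ be linearly independent real symmetric $m\times m$ matrices, write $A(x)=x_1A_1+\cdots+x_nA_n$, and assume that the spectrahedral cone $$C=\{x\in\mathbb{R}^n : A(x)\ \text{is positive definite}\}$$ is non-empty. Let $p(x)=\det A(x)$, and let $\alpha\in\{0,\tfrac12,1,\tfrac32,\dots,\tfrac{m-1}{2}\}$ or $\alpha>\tfrac{m-1}{2}$. Then: 1. The function $p^{-\alpha}$ is completely monotone on $C$: it is $C^\infty$ on $C$ and $(-1)^kD_{v_1}\cdots D_{v_k}\,p^{-\alpha}(x)\ge 0$ for all $k\in\mathbb{N}$, $v_1,\dots,v_k\in C$ and $x\in C$, where $D_v$ is the directional derivative along $v$. 2. The Riesz measure of $p^{-\alpha}$, that is, the unique Borel measure $\mu$ on $(\mathbb{R}^n)^*$ that is supported on the dual cone $C^*=\{y:\langle y,x\rangle\ge 0\ \text{for all } x\in C\}$ and satisfies $$p(x)^{-\alpha}=\int_{C^*}e^{-\langle y,x\rangle}\,d\mu(y)\qquad\text{for all } x\in C,$$ is the push-forward $L_*\mu_\alpha$. Here $L$ is the linear map dual to $x\mapsto A(x)$ with respect to the trace pairing,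 $\langle L(Y),x\rangle=\operatorname{tr}(A(x)Y)$, and $\mu_\alpha$ is the following measure on the positive semidefinite symmetric $m\times m$ matrices (the Riesz measure of $\det^{-\alpha}$ on the positive definite cone): - if $\alpha>\frac{m-1}{2}$, then $\mu_\alpha$ has the density $$\Bigl(\pi^{m(m-1)/4}\prod_{j=0}^{m-1}\Gamma\bigl(\alpha-\tfrac j2\bigr)\Bigr)^{-1}\det(Y)^{\alpha-\frac{m+1}{2}}$$ with respect to Lebesgue measure $\prod_{i\le j}dY_{ij}$; - if $\alpha=\frac r2$ with $r\in\{0,1,\dots,m-1\}$, then $\mu_\alpha$ is the push-forward of $\pi^{-mr/2}\,dZ$ on $\mathbb{R}^{m\times r}$ under $Z\mapsto ZZ^{T}$. -/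

import Mathlib

open MeasureTheory Matrix
open scoped ContDiff

noncomputable section

/-- Iterated directional derivatives: `dirDeriv [v₁, …, vₖ] f = D_{v₁} ⋯ D_{vₖ} f`. -/
def dirDeriv {V : Type*} [NormedAddCommGroup V] [NormedSpace ℝ V] :
    List V → (V → ℝ) → (V → ℝ)
  | [], f => f
  | v :: l, f => fun x => lineDeriv ℝ (dirDeriv l f) x v

/-- Complete monotonicity of `f` on an open convex cone `C`: `f` is smooth on `C` and
`(-1)ᵏ D_{v₁} ⋯ D_{vₖ} f ≥ 0` on `C` for all `k` and all `v₁, …, vₖ ∈ C`. -/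
def CompletelyMonotoneOn {V : Type*} [NormedAddCommGroup V] [NormedSpace ℝ V]
    (f : V → ℝ) (C : Set V) : Prop :=
  ContDiffOn ℝ ∞ f C ∧
    ∀ l : List V, (∀ v ∈ l, v ∈ C) → ∀ x ∈ C, 0 ≤ (-1 : ℝ) ^ l.length * dirDeriv l f x

/-- The closed dual cone `C* = {y ∈ V* : y x ≥ 0 for all x ∈ C}`. -/
def closedDualCone {V : Type*} [NormedAddCommGroup V] [NormedSpace ℝ V] (C : Set V) :
    Set (StrongDual ℝ V) :=
  {y | ∀ x ∈ C, 0 ≤ y x}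

/-- `μ` is a Borel measure on `V*` that is supported on `C*` and whose Laplace transform
converges and equals `f` on `C`. -/
def IsRieszMeasure {V : Type*} [NormedAddCommGroup V] [NormedSpace ℝ V]
    (f : V → ℝ) (C : Set V) (μ : Measure (StrongDual ℝ V)) : Prop :=
  μ (closedDualCone C)ᶜ = 0 ∧
    ∀ x ∈ C, Integrable (fun y : StrongDual ℝ V => Real.exp (-(y x))) μ ∧
      ∫ y : StrongDual ℝ V, Real.exp (-(y x)) ∂μ = f x

/-- Real matrices carry the product (equivalently, Borel) `σ`-algebra. -/
instance matrixMeasurableSpace (m : ℕ) : MeasurableSpace (Matrix (Fin m) (Fin m) ℝ) :=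
  inferInstanceAs (MeasurableSpace (Fin m → Fin m → ℝ))

instance matrixBorelSpace (m : ℕ) : BorelSpace (Matrix (Fin m) (Fin m) ℝ) :=
  inferInstanceAs (BorelSpace (Fin m → Fin m → ℝ))

/-- The symmetric `m × m` matrix with entries `y_{ij} = y_{ji}`; the coordinates are indexed by
unordered pairs (with repetition), so that the coordinate space is `ℝ^{m(m+1)/2}`. -/
def symMatrix (m : ℕ) (y : Sym2 (Fin m) → ℝ) : Matrix (Fin m) (Fin m) ℝ :=
  Matrix.of fun i j => y s(i, j)

/-- The density
`(π^{m(m-1)/4} ∏_{j=0}^{m-1} Γ(α - j/2))⁻¹ det(y)^{α - (m+1)/2}` on the psd cone.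
It is set to zero off the positive definite cone; the boundary of the cone is a null set. -/
def detRieszKernel (m : ℕ) (α : ℝ) (y : Matrix (Fin m) (Fin m) ℝ) : ℝ :=
  {Y : Matrix (Fin m) (Fin m) ℝ | Y.PosDef}.indicator
    (fun Y => (Real.pi ^ ((m : ℝ) * ((m : ℝ) - 1) / 4) *
      ∏ j ∈ Finset.range m, Real.Gamma (α - (j : ℝ) / 2))⁻¹ *
        Y.det ^ (α - ((m : ℝ) + 1) / 2)) y

/-- The measure on symmetric matrices with density `detRieszKernel` with respect to the Lebesgue
measure `∏_{i ≤ j} dy_{ij}`. -/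
def wishartDensityMeasure (m : ℕ) (α : ℝ) : Measure (Matrix (Fin m) (Fin m) ℝ) :=
  Measure.map (symMatrix m)
    ((volume : Measure (Sym2 (Fin m) → ℝ)).withDensity
      fun y => ENNReal.ofReal (detRieszKernel m α (symMatrix m y)))

/-- The push-forward of `π^{-mr/2} dZ` on `m × r` matrices under `Z ↦ Z Zᵀ`. -/
def wishartSingularMeasure (m r : ℕ) : Measure (Matrix (Fin m) (Fin m) ℝ) :=
  ENNReal.ofReal (Real.pi ^ (-((m : ℝ) * (r : ℝ) / 2))) •
    Measure.map (fun Z : Fin m → Fin r → ℝ => Matrix.of Z * (Matrix.of Z)ᵀ) volume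

open Classical in
/-- The explicit Riesz measure of `det^{-α}` on psd `m × m` matrices, where `V*` is identified with
the symmetric matrices by the trace pairing: given by a density if `α > (m-1)/2`, and by the image
of Lebesgue measure on `m × r` matrices if `α = r/2` with `r ∈ {0, …, m-1}`. -/
def detRieszMeasure (m : ℕ) (α : ℝ) : Measure (Matrix (Fin m) (Fin m) ℝ) :=
  if ((m : ℝ) - 1) / 2 < α then wishartDensityMeasure m α
  else wishartSingularMeasure m ⌊2 * α⌋₊

/-- The linear map `x ↦ x₁ A₁ + ⋯ + xₙ Aₙ`. -/
def pencil {m n : ℕ} (A : Fin n → Matrix (Fin m) (Fin m) ℝ) :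
    (Fin n → ℝ) →ₗ[ℝ] Matrix (Fin m) (Fin m) ℝ where
  toFun x := ∑ i, x i • A i
  map_add' x y := by simp [add_smul, Finset.sum_add_distrib]
  map_smul' c x := by simp [mul_smul, Finset.smul_sum]

/-- The spectrahedral cone of the pencil. -/
def spectrahedralCone {m n : ℕ} (A : Fin n → Matrix (Fin m) (Fin m) ℝ) : Set (Fin n → ℝ) :=
  {x | (pencil A x).PosDef}

/-- The linear map `L` dual to `pencil A` with respect to the trace pairing:
`L(Y)` is the linear form `x ↦ trace (A(x) Y)`. -/
def dualPencil {m n : ℕ} (A : Fin n → Matrix (Fin m) (Fin m) ℝ) :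
    Matrix (Fin m) (Fin m) ℝ →ₗ[ℝ] StrongDual ℝ (Fin n → ℝ) where
  toFun Y := LinearMap.toContinuousLinearMap
    { toFun := fun x => (pencil A x * Y).trace
      map_add' := fun x y => by simp [add_mul]
      map_smul' := fun c x => by simp }
  map_add' Y Z := by ext x; simp [mul_add]
  map_smul' c Y := by ext x; simp

end

/-! ### Laplace transforms on the dual space: derivatives and uniqueness -/

section Laplace

open ProbabilityTheory Filter Topology

variable {V : Type*} [NormedAddCommGroup V] [NormedSpace ℝ V]

/-! Both claims reduce to one Laplace transform. Since `L(Y)` pairs with `x` to `tr(A(x) Y)`, the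
transform of the push-forward at `x` is that of `μ_α` at the positive definite matrix `X = A(x)`, so
the computation needed is `∫ exp(-tr(XY)) dμ_α(Y) = (det X)^(-α)`.

For `α = r/2` this is a product of `r` Gaussian integrals, one for each column of `Z`
(`lintegral_exp_neg_trace_mul_transpose`). For `α > (m-1)/2` it is Siegel's matrix Gamma integral
(`lintegral_matrixGammaIntegrand`), by induction on `m`: a Schur complement splits `Y` into a corner
entry, a row and a smaller positive definite block, contributing a Gamma integral, a Gaussian
integral, and the same problem with `α - 1/2`.

Complete monotonicity is differentiation under the integral (`IsRieszMeasure.neg_lineDeriv`): `-D_v`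
multiplies the measure by `y v`, which is nonnegative on the dual cone. Uniqueness
(`IsRieszMeasure.unique`) comes from an exponential tilt that makes the measure finite, followed by
analytic continuation from the moment generating function to the characteristic function. -/

theorem IsRieszMeasure.congr {f g : V → ℝ} {C : Set V} {μ : Measure (StrongDual ℝ V)}
    (h : IsRieszMeasure f C μ) (hfg : ∀ x ∈ C, f x = g x) : IsRieszMeasure g C μ :=
  ⟨h.1, fun x hx => ⟨(h.2 x hx).1, (h.2 x hx).2.trans (hfg x hx)⟩⟩

theorem measurable_dual_apply (v : V) : Measurable fun y : StrongDual ℝ V => y v :=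
  (ContinuousLinearMap.apply ℝ ℝ v).continuous.measurable

theorem IsRieszMeasure.ae_nonneg {f : V → ℝ} {C : Set V} {μ : Measure (StrongDual ℝ V)}
    (h : IsRieszMeasure f C μ) {v : V} (hv : v ∈ C) : ∀ᵐ y ∂μ, 0 ≤ y v := by
  have : ∀ᵐ y ∂μ, y ∈ closedDualCone C := h.1
  filter_upwards [this] with y hy using hy v hv

/-- Minus the derivative of a Laplace transform along a vector `v` of the cone is the Laplace
transform of the measure with density `y ↦ y v`. -/
theorem IsRieszMeasure.neg_lineDeriv {f : V → ℝ} {C : Set V} {μ : Measure (StrongDual ℝ V)}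
    (hC : IsOpen C) (h : IsRieszMeasure f C μ) {v : V} (hv : v ∈ C) :
    IsRieszMeasure (fun x => -lineDeriv ℝ f x v) C
      (μ.withDensity fun y => ENNReal.ofReal (y v)) := by
  refine ⟨withDensity_absolutelyContinuous _ _ h.1, fun x hx => ?_⟩
  have hcont : Continuous fun t : ℝ => x + t • v := by fun_prop
  have hnhds : ∀ᶠ t : ℝ in 𝓝 0, x + t • v ∈ C :=
    (hcont.tendsto 0).eventually (hC.mem_nhds (by simpa using hx))
  obtain ⟨ε, hε, hball⟩ := Metric.eventually_nhds_iff_ball.1 hnhds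
  have hδ : 0 < ε / 4 := by positivity
  set δ := ε / 4 with hδdef
  -- The dominating function is a multiple of the Laplace integrand at `x - 2δv`: one `δ` absorbs
  -- the factor `y v`, the other the displacement `|t| < δ`. The choice `δ = ε/4` keeps this point
  -- in the cone.
  have hxδ : x + (-(2 * δ)) • v ∈ C := hball _ (by
    rw [Metric.mem_ball, dist_zero_right, Real.norm_eq_abs, abs_neg, abs_of_pos (by positivity)]
    linarith)
  have hder := hasDerivAt_integral_of_dominated_loc_of_deriv_le (μ := μ) (x₀ := (0 : ℝ))
    (F := fun t (y : StrongDual ℝ V) => Real.exp (-(y (x + t • v))))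
    (F' := fun t (y : StrongDual ℝ V) => -(y v * Real.exp (-(y (x + t • v)))))
    (bound := fun y => δ⁻¹ * Real.exp (-(y (x + (-(2 * δ)) • v))))
    (Metric.ball_mem_nhds 0 hδ)
    (.of_forall fun t => ((measurable_dual_apply _).neg.exp).aestronglyMeasurable)
    (by simpa using (h.2 x hx).1)
    (((measurable_dual_apply _).mul (measurable_dual_apply _).neg.exp).neg.aestronglyMeasurable)
    (by
      filter_upwards [h.ae_nonneg hv] with y hy t ht
      rw [norm_neg, norm_mul, Real.norm_eq_abs, Real.norm_eq_abs, Real.abs_exp, abs_of_nonneg hy]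
      have h1 : y v ≤ δ⁻¹ * Real.exp (δ * y v) := by
        rw [inv_mul_eq_div, le_div_iff₀ hδ]
        nlinarith [Real.add_one_le_exp (δ * y v)]
      have h2 : -(y (x + t • v)) ≤ -(y x) + δ * y v := by
        rw [Metric.mem_ball, dist_zero_right, Real.norm_eq_abs] at ht
        simp only [map_add, map_smul, smul_eq_mul]
        nlinarith [neg_abs_le t]
      calc y v * Real.exp (-(y (x + t • v)))
          ≤ (δ⁻¹ * Real.exp (δ * y v)) * Real.exp (-(y x) + δ * y v) := by gcongr
        _ = δ⁻¹ * Real.exp (-(y (x + (-(2 * δ)) • v))) := by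
          rw [mul_assoc, ← Real.exp_add]
          congr 2
          simp only [map_add, map_smul, smul_eq_mul]
          ring)
    ((h.2 _ hxδ).1.const_mul _)
    (.of_forall fun y t _ => by
      have : HasDerivAt (fun t : ℝ => -(y (x + t • v))) (-(y v)) t := by
        simp only [map_add, map_smul, smul_eq_mul]
        exact (((hasDerivAt_mul_const (y v)).const_add (y x)).neg)
      simpa [mul_comm] using this.exp)
  have hline : lineDeriv ℝ f x v = ∫ y : StrongDual ℝ V, -(y v * Real.exp (-(y x))) ∂μ := by
    have h1 : (fun t : ℝ => f (x + t • v)) =ᶠ[𝓝 0]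
        fun t => ∫ y : StrongDual ℝ V, Real.exp (-(y (x + t • v))) ∂μ := by
      filter_upwards [hnhds] with t ht using (h.2 _ ht).2.symm
    rw [lineDeriv, h1.deriv_eq, hder.2.deriv]
    simp
  have hint := hder.1
  simp only [zero_smul, add_zero] at hint
  have hmeas : Measurable fun y : StrongDual ℝ V => ENNReal.ofReal (y v) :=
    (measurable_dual_apply v).ennreal_ofReal
  have hfin : ∀ᵐ y : StrongDual ℝ V ∂μ, ENNReal.ofReal (y v) < ⊤ :=
    .of_forall fun _ => ENNReal.ofReal_lt_top
  have heq : (fun y : StrongDual ℝ V => (ENNReal.ofReal (y v)).toReal • Real.exp (-(y x)))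
      =ᵐ[μ] fun y => y v * Real.exp (-(y x)) := by
    filter_upwards [h.ae_nonneg hv] with y hy
    rw [ENNReal.toReal_ofReal hy, smul_eq_mul]
  constructor
  · rw [integrable_withDensity_iff_integrable_smul' hmeas hfin, integrable_congr heq]
    simpa using hint.neg
  · rw [integral_withDensity_eq_integral_toReal_smul hmeas hfin, integral_congr_ae heq]
    simp only [hline, integral_neg, neg_neg]

/-- Each `-D_v` again yields the transform of a positive measure supported on the dual cone, so the
derivative lemma can be iterated. -/
theorem IsRieszMeasure.exists_dirDeriv {f : V → ℝ} {C : Set V} {μ : Measure (StrongDual ℝ V)}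
    (hC : IsOpen C) (h : IsRieszMeasure f C μ) (l : List V) (hl : ∀ v ∈ l, v ∈ C) :
    ∃ ν, IsRieszMeasure (fun x => (-1) ^ l.length * dirDeriv l f x) C ν := by
  induction l with
  | nil => exact ⟨μ, by simpa [dirDeriv] using h⟩
  | cons v l ih =>
    obtain ⟨ν, hν⟩ := ih fun w hw => hl w (List.mem_cons_of_mem _ hw)
    refine ⟨_, (hν.neg_lineDeriv hC (hl v List.mem_cons_self)).congr fun x _ => ?_⟩
    simp only [lineDeriv, dirDeriv, deriv_const_mul_field, List.length_cons, pow_succ]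
    ring

theorem IsRieszMeasure.completelyMonotoneOn {f : V → ℝ} {C : Set V}
    {μ : Measure (StrongDual ℝ V)} (hC : IsOpen C) (h : IsRieszMeasure f C μ)
    (hf : ContDiffOn ℝ ∞ f C) : CompletelyMonotoneOn f C := by
  refine ⟨hf, fun l hl x hx => ?_⟩
  obtain ⟨ν, hν⟩ := h.exists_dirDeriv hC l hl
  refine (integral_nonneg fun y => ?_).trans_eq (hν.2 x hx).2
  exact (Real.exp_pos _).le

/-- Identity theorem: both complex moment generating functions are holomorphic on a common vertical
strip around the imaginary axis and agree at real points accumulating at `0`. -/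
theorem complexMGF_I_eq_of_mgf_eventuallyEq {Ω Ω' : Type*} {_ : MeasurableSpace Ω}
    {_ : MeasurableSpace Ω'} {X : Ω → ℝ} {Y : Ω' → ℝ} {μ : Measure Ω} {ν : Measure Ω'}
    (hX : 0 ∈ interior (integrableExpSet X μ)) (hY : 0 ∈ interior (integrableExpSet Y ν))
    (h : mgf X μ =ᶠ[𝓝 0] mgf Y ν) : complexMGF X μ Complex.I = complexMGF Y ν Complex.I := by
  set U : Set ℂ := {z | z.re ∈ interior (integrableExpSet X μ) ∩ interior (integrableExpSet Y ν)}
  have hXU : AnalyticOnNhd ℂ (complexMGF X μ) U :=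
    analyticOnNhd_complexMGF.mono fun z hz => hz.1
  have hYU : AnalyticOnNhd ℂ (complexMGF Y ν) U :=
    analyticOnNhd_complexMGF.mono fun z hz => hz.2
  have hU : IsPreconnected U :=
    ((convex_integrableExpSet.interior.inter
      convex_integrableExpSet.interior).linear_preimage Complex.reLm).isPreconnected
  refine AnalyticOnNhd.eqOn_of_preconnected_of_frequently_eq hXU hYU hU
    (z₀ := ((0 : ℝ) : ℂ)) ⟨by simpa using hX, by simpa using hY⟩ ?_
    ⟨by simpa using hX, by simpa using hY⟩
  have h_real : ∃ᶠ x : ℝ in 𝓝[≠] 0, complexMGF X μ x = complexMGF Y ν x := by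
    refine Eventually.frequently ?_
    filter_upwards [h.filter_mono nhdsWithin_le_nhds] with y hy
    rw [complexMGF_ofReal, complexMGF_ofReal, hy]
  have hmap : Tendsto (fun x : ℝ => (x : ℂ)) (𝓝[≠] 0) (𝓝[≠] ((0 : ℝ) : ℂ)) :=
    tendsto_nhdsWithin_of_tendsto_nhds_of_eventually_within _
      (Complex.continuous_ofReal.continuousAt.mono_left nhdsWithin_le_nhds)
      (by filter_upwards [self_mem_nhdsWithin] with x hx; simpa using hx)
  exact hmap.frequently h_real

/-- Reflexivity in finite dimension; it turns a characteristic function on the dual space into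
one-dimensional transforms of `y ↦ y v`. -/
theorem exists_eq_apply_of_dual_dual [FiniteDimensional ℝ V]
    (L : StrongDual ℝ (StrongDual ℝ V)) : ∃ v : V, ∀ y, L y = y v := by
  obtain ⟨v, hv⟩ := (Module.evalEquiv ℝ V).surjective
    (L.toLinearMap ∘ₗ (LinearMap.toContinuousLinearMap : (V →ₗ[ℝ] ℝ) ≃ₗ[ℝ] (V →L[ℝ] ℝ)).toLinearMap)
  refine ⟨v, fun y => ?_⟩
  have := LinearMap.congr_fun hv y.toLinearMap
  exact this.symm

/-- A measure on the dual space is determined by its Laplace transform on a non-empty open set. -/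
theorem IsRieszMeasure.unique [FiniteDimensional ℝ V] {f : V → ℝ} {C : Set V}
    {μ ν : Measure (StrongDual ℝ V)} (hC : IsOpen C) (hne : C.Nonempty)
    (hμ : IsRieszMeasure f C μ) (hν : IsRieszMeasure f C ν) : μ = ν := by
  obtain ⟨x₀, hx₀⟩ := hne
  have hmeas : Measurable fun y : StrongDual ℝ V => ENNReal.ofReal (Real.exp (-(y x₀))) :=
    (measurable_dual_apply x₀).neg.exp.ennreal_ofReal
  have hfin (y : StrongDual ℝ V) : ENNReal.ofReal (Real.exp (-(y x₀))) < ⊤ :=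
    ENNReal.ofReal_lt_top
  have hmul (v : V) (t : ℝ) (y : StrongDual ℝ V) :
      (ENNReal.ofReal (Real.exp (-(y x₀)))).toReal • Real.exp (t * y v) =
        Real.exp (-(y (x₀ - t • v))) := by
    rw [ENNReal.toReal_ofReal (Real.exp_pos _).le, smul_eq_mul, ← Real.exp_add]
    congr 1
    simp only [map_sub, map_smul, smul_eq_mul]
    ring
  -- After tilting by `exp(-y x₀)`, the moment generating function of `y ↦ y v` at `t` is `f (x₀ - t
  -- • v)`, hence determined by `f` for small `t`.
  have key (ρ : Measure (StrongDual ℝ V)) (hρ : IsRieszMeasure f C ρ) (v : V) (t : ℝ)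
      (ht : x₀ - t • v ∈ C) :
      Integrable (fun y : StrongDual ℝ V => Real.exp (t * y v))
        (ρ.withDensity fun y => ENNReal.ofReal (Real.exp (-(y x₀)))) ∧
      mgf (fun y : StrongDual ℝ V => y v)
        (ρ.withDensity fun y => ENNReal.ofReal (Real.exp (-(y x₀)))) t = f (x₀ - t • v) := by
    constructor
    · rw [integrable_withDensity_iff_integrable_smul' hmeas (.of_forall hfin)]
      simpa only [hmul] using (hρ.2 _ ht).1
    · rw [mgf, integral_withDensity_eq_integral_toReal_smul hmeas (.of_forall hfin)]
      simpa only [hmul] using (hρ.2 _ ht).2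
  have hfinite (ρ : Measure (StrongDual ℝ V)) (hρ : IsRieszMeasure f C ρ) :
      IsFiniteMeasure (ρ.withDensity fun y => ENNReal.ofReal (Real.exp (-(y x₀)))) :=
    isFiniteMeasure_withDensity_ofReal (hρ.2 x₀ hx₀).1.2
  have hev (v : V) : ∀ᶠ t : ℝ in 𝓝 0, x₀ - t • v ∈ C := by
    have hcont : Continuous fun t : ℝ => x₀ - t • v := by fun_prop
    exact (hcont.tendsto 0).eventually (hC.mem_nhds (by simpa using hx₀))
  have htilt : (μ.withDensity fun y => ENNReal.ofReal (Real.exp (-(y x₀)))) =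
      ν.withDensity fun y => ENNReal.ofReal (Real.exp (-(y x₀))) := by
    have := hfinite μ hμ
    have := hfinite ν hν
    have : ProperSpace (StrongDual ℝ V) := FiniteDimensional.proper_real (StrongDual ℝ V)
    refine Measure.ext_of_charFunDual (funext fun L => ?_)
    obtain ⟨v, hv⟩ := exists_eq_apply_of_dual_dual L
    have hI := complexMGF_I_eq_of_mgf_eventuallyEq (X := fun y : StrongDual ℝ V => y v)
      (Y := fun y : StrongDual ℝ V => y v)
      (μ := μ.withDensity fun y => ENNReal.ofReal (Real.exp (-(y x₀))))
      (ν := ν.withDensity fun y => ENNReal.ofReal (Real.exp (-(y x₀))))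
      (mem_interior_iff_mem_nhds.2 ((hev v).mono fun t ht => (key μ hμ v t ht).1))
      (mem_interior_iff_mem_nhds.2 ((hev v).mono fun t ht => (key ν hν v t ht).1))
      ((hev v).mono fun t ht => (key μ hμ v t ht).2.trans (key ν hν v t ht).2.symm)
    simpa only [charFunDual_apply, hv, complexMGF, mul_comm Complex.I] using hI
  -- The tilting density is positive and finite, so the tilt can be undone.
  have hinv (ρ : Measure (StrongDual ℝ V)) :
      (ρ.withDensity fun y => ENNReal.ofReal (Real.exp (-(y x₀)))).withDensity
        (fun y => (ENNReal.ofReal (Real.exp (-(y x₀))))⁻¹) = ρ :=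
    withDensity_inv_same hmeas
      (.of_forall fun y => by simpa using Real.exp_pos _) (.of_forall fun y => (hfin y).ne)
  rw [← hinv μ, htilt, hinv ν]

end Laplace

/-! ### Positive definite matrices -/

section PosDef

/-- The complement is the projection, along the compact unit sphere, of the closed set where the
quadratic form is nonpositive; such projections are closed maps. -/
theorem isOpen_setOf_posDef {E ι : Type*} [TopologicalSpace E] [Fintype ι]
    {f : E → Matrix ι ι ℝ} (hf : Continuous f) (hs : ∀ x, (f x).IsHermitian) :
    IsOpen {x | (f x).PosDef} := by
  have hset : {x | (f x).PosDef}ᶜ = Prod.snd ''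
      {p : Metric.sphere (0 : ι → ℝ) 1 × E | (p.1 : ι → ℝ) ⬝ᵥ (f p.2 *ᵥ (p.1 : ι → ℝ)) ≤ 0} := by
    ext x
    simp only [Set.mem_compl_iff, Set.mem_ofPred_eq, Set.mem_image, Prod.exists, exists_eq_right]
    rw [posDef_iff_dotProduct_mulVec]
    constructor
    · intro h
      push Not at h
      obtain ⟨v, hv, hle⟩ := h (hs x)
      refine ⟨⟨‖v‖⁻¹ • v, by simp [norm_smul, hv]⟩, ?_⟩
      simp only [mulVec_smul, dotProduct_smul, smul_dotProduct, smul_eq_mul]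
      simp only [star_trivial] at hle
      exact mul_nonpos_of_nonneg_of_nonpos (by positivity)
        (mul_nonpos_of_nonneg_of_nonpos (by positivity) hle)
    · rintro ⟨v, hv⟩ ⟨-, h⟩
      have := h (x := (v : ι → ℝ)) (by
        rintro h0
        have := v.2
        rw [h0] at this
        simp at this)
      simp only [star_trivial] at this
      linarith
  rw [← isClosed_compl_iff, hset]
  refine isClosedMap_snd_of_compactSpace _ (isClosed_le ?_ continuous_const)
  have h1 : Continuous fun p : Metric.sphere (0 : ι → ℝ) 1 × E => (p.1 : ι → ℝ) := by fun_prop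
  have h2 : Continuous fun p : Metric.sphere (0 : ι → ℝ) 1 × E => f p.2 := by fun_prop
  exact h1.dotProduct (h2.matrix_mulVec h1)

theorem Matrix.PosDef.exists_det_ne_zero_eq_transpose_mul_self {ι : Type*} [Fintype ι]
    [DecidableEq ι] {Q : Matrix ι ι ℝ} (hQ : Q.PosDef) :
    ∃ B : Matrix ι ι ℝ, B.det ≠ 0 ∧ Q = Bᵀ * B := by
  open scoped MatrixOrder in
  obtain ⟨B, hB⟩ := CStarAlgebra.nonneg_iff_eq_star_mul_self.mp hQ.posSemidef.nonneg
  rw [star_eq_conjTranspose, conjTranspose_eq_transpose_of_trivial] at hB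
  refine ⟨B, fun h => hQ.det_pos.ne' ?_, hB⟩
  rw [hB, det_mul, h, mul_zero]

/-- With `X = Bᵀ B`, the trace equals that of the positive semidefinite matrix `B Y Bᵀ`. This places
the push-forward on the dual cone. -/
theorem Matrix.PosDef.trace_mul_nonneg {ι : Type*} [Fintype ι] [DecidableEq ι]
    {X Y : Matrix ι ι ℝ} (hX : X.PosDef) (hY : Y.PosSemidef) : 0 ≤ (X * Y).trace := by
  obtain ⟨B, -, rfl⟩ := hX.exists_det_ne_zero_eq_transpose_mul_self
  rw [Matrix.mul_assoc, trace_mul_comm]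
  simpa using (hY.mul_mul_conjTranspose_same B).trace_nonneg

end PosDef

/-! ### Gaussian and scalar Gamma integrals -/

section Gaussian

open Real

theorem lintegral_exp_neg_dotProduct_self (ι : Type*) [Fintype ι] :
    ∫⁻ b : ι → ℝ, ENNReal.ofReal (exp (-(b ⬝ᵥ b))) =
      ENNReal.ofReal (π ^ ((Fintype.card ι : ℝ) / 2)) := by
  have hprod (b : ι → ℝ) : exp (-(b ⬝ᵥ b)) = ∏ i, exp (-1 * b i ^ 2) := by
    rw [← exp_sum]
    simp [dotProduct, pow_two]
  have hint : Integrable fun b : ι → ℝ => ∏ i, exp (-1 * b i ^ 2) :=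
    Integrable.fintype_prod fun _ => integrable_exp_neg_mul_sq one_pos
  simp_rw [hprod]
  rw [← ofReal_integral_eq_lintegral_ofReal hint
    (.of_forall fun b => Finset.prod_nonneg fun _ _ => (exp_pos _).le),
    integral_fintype_prod_volume_eq_prod (fun _ t => exp (-1 * t ^ 2))]
  simp only [integral_gaussian, div_one, Finset.prod_const, Finset.card_univ]
  rw [sqrt_eq_rpow, ← rpow_natCast, ← rpow_mul pi_pos.le]
  congr 2
  ring

/-- Substituting `B b` for `b`, where `Q = Bᵀ B`, reduces to the standard Gaussian with Jacobian
`|det B|⁻¹ = (det Q)^(-1/2)`. -/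
theorem lintegral_exp_neg_dotProduct_mulVec {ι : Type*} [Fintype ι] [DecidableEq ι]
    {Q : Matrix ι ι ℝ} (hQ : Q.PosDef) :
    ∫⁻ b : ι → ℝ, ENNReal.ofReal (exp (-(b ⬝ᵥ (Q *ᵥ b)))) =
      ENNReal.ofReal (π ^ ((Fintype.card ι : ℝ) / 2) * Q.det ^ (-(1 / 2) : ℝ)) := by
  obtain ⟨B, hB, rfl⟩ := hQ.exists_det_ne_zero_eq_transpose_mul_self
  have hq (b : ι → ℝ) : b ⬝ᵥ ((Bᵀ * B) *ᵥ b) = toLin' B b ⬝ᵥ toLin' B b := by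
    rw [toLin'_apply, ← mulVec_mulVec, dotProduct_mulVec, vecMul_transpose]
  have hmeas : Measurable fun b : ι → ℝ => ENNReal.ofReal (exp (-(b ⬝ᵥ b))) := by
    unfold dotProduct
    fun_prop
  simp_rw [hq]
  rw [← lintegral_map (f := fun b : ι → ℝ => ENNReal.ofReal (exp (-(b ⬝ᵥ b)))) hmeas
    (LinearMap.continuous_on_pi _).measurable,
    Real.map_matrix_volume_pi_eq_smul_volume_pi hB, lintegral_smul_measure,
    lintegral_exp_neg_dotProduct_self, smul_eq_mul, ← ENNReal.ofReal_mul (abs_nonneg _), mul_comm]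
  congr 2
  rw [det_mul, det_transpose, ← abs_mul_abs_self, ← pow_two, abs_inv, ← rpow_natCast,
    ← rpow_mul (abs_nonneg _), ← rpow_neg_one]
  norm_num

theorem lintegral_rpow_mul_exp_neg_mul {a s : ℝ} (ha : 0 < a) (hs : 0 < s) :
    ∫⁻ t in Set.Ioi 0, ENNReal.ofReal (t ^ (a - 1) * exp (-(s * t))) =
      ENNReal.ofReal (Gamma a * s ^ (-a)) := by
  rw [← ofReal_integral_eq_lintegral_ofReal, integral_rpow_mul_exp_neg_mul_Ioi ha hs, one_div,
    inv_rpow hs.le, rpow_neg hs.le, mul_comm]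
  -- Integrability comes for free: the integral of a non-integrable function is `0` by convention,
  -- whereas the known value is positive.
  · by_contra h
    have h0 := integral_undef h
    rw [integral_rpow_mul_exp_neg_mul_Ioi ha hs] at h0
    have := Gamma_pos_of_pos ha
    exact absurd h0 (by positivity)
  · filter_upwards [ae_restrict_mem measurableSet_Ioi] with t ht
    have : 0 < t := ht
    positivity

end Gaussian

/-! ### Bordered matrices and Schur complements -/

section Bordered

variable {m : ℕ}

/-- The square matrix with corner entry `a`, first row `b`, first column `c` and remaining
block `D`. -/
def borderedMatrix (a : ℝ) (b c : Fin m → ℝ) (D : Matrix (Fin m) (Fin m) ℝ) :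
    Matrix (Fin (m + 1)) (Fin (m + 1)) ℝ :=
  Matrix.of (Fin.cons (Fin.cons a b) fun i => Fin.cons (c i) (D i))

variable (a a' : ℝ) (b b' c c' : Fin m → ℝ) (D D' : Matrix (Fin m) (Fin m) ℝ)

@[simp] theorem borderedMatrix_zero_zero : borderedMatrix a b c D 0 0 = a := rfl

@[simp] theorem borderedMatrix_zero_succ (j : Fin m) :
    borderedMatrix a b c D 0 j.succ = b j := rfl

@[simp] theorem borderedMatrix_succ_zero (i : Fin m) :
    borderedMatrix a b c D i.succ 0 = c i := rfl

@[simp] theorem borderedMatrix_succ_succ (i j : Fin m) :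
    borderedMatrix a b c D i.succ j.succ = D i j := rfl

theorem eq_borderedMatrix (M : Matrix (Fin (m + 1)) (Fin (m + 1)) ℝ) :
    M = borderedMatrix (M 0 0) (fun j => M 0 j.succ) (fun i => M i.succ 0)
      (M.submatrix Fin.succ Fin.succ) := by
  ext i j
  refine Fin.cases ?_ (fun i => ?_) i <;> refine Fin.cases ?_ (fun j => ?_) j <;> simp

theorem borderedMatrix_mul : borderedMatrix a b c D * borderedMatrix a' b' c' D' =
    borderedMatrix (a * a' + b ⬝ᵥ c') (a • b' + b ᵥ* D') (a' • c + D *ᵥ c')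
      (vecMulVec c b' + D * D') := by
  ext i j
  refine Fin.cases ?_ (fun i => ?_) i <;> refine Fin.cases ?_ (fun j => ?_) j <;>
    simp [mul_apply, Fin.sum_univ_succ, dotProduct, vecMul, mulVec, vecMulVec_apply, mul_comm]

theorem borderedMatrix_transpose :
    (borderedMatrix a b c D)ᵀ = borderedMatrix a c b Dᵀ := by
  ext i j
  refine Fin.cases ?_ (fun i => ?_) i <;> refine Fin.cases ?_ (fun j => ?_) j <;> simp

theorem trace_borderedMatrix : (borderedMatrix a b c D).trace = a + D.trace := by
  simp [trace, Fin.sum_univ_succ]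

theorem det_borderedMatrix_zero_left : (borderedMatrix a 0 c D).det = a * D.det := by
  rw [det_succ_row_zero, Fin.sum_univ_succ]
  have : (borderedMatrix a 0 c D).submatrix Fin.succ Fin.succ = D := by ext i j; simp
  simp [this]

theorem det_borderedMatrix_zero_right : (borderedMatrix a b 0 D).det = a * D.det := by
  rw [← det_transpose, borderedMatrix_transpose, det_borderedMatrix_zero_left, det_transpose]

theorem posDef_borderedMatrix_zero_zero :
    (borderedMatrix a 0 0 D).PosDef ↔ 0 < a ∧ D.PosDef := by
  have hq (v : Fin (m + 1) → ℝ) : v ⬝ᵥ (borderedMatrix a 0 0 D *ᵥ v) =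
      a * v 0 ^ 2 + (fun i : Fin m => v i.succ) ⬝ᵥ (D *ᵥ fun i : Fin m => v i.succ) := by
    simp only [dotProduct, mulVec, Fin.sum_univ_succ, borderedMatrix_zero_zero,
      borderedMatrix_zero_succ, borderedMatrix_succ_zero, borderedMatrix_succ_succ, Pi.zero_apply,
      zero_mul, Finset.sum_const_zero, zero_add, add_zero]
    ring
  constructor
  · intro h
    refine ⟨h.diag_pos (i := 0), ?_⟩
    have : D = (borderedMatrix a 0 0 D).submatrix Fin.succ Fin.succ := by ext i j; simp
    rw [this]
    exact h.submatrix (Fin.succ_injective m)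
  · rintro ⟨ha, hD⟩
    refine .of_dotProduct_mulVec_pos ?_ fun v hv => ?_
    · rw [IsHermitian, conjTranspose_eq_transpose_of_trivial, borderedMatrix_transpose]
      congr 1
      exact hD.1
    · rw [star_trivial, hq]
      by_cases ht : (fun i : Fin m => v i.succ) = 0
      · have h0 : v 0 ≠ 0 := by
          intro h0
          apply hv
          ext i
          refine Fin.cases h0 (fun i => congrFun ht i) i
        rw [ht]
        simp only [mulVec_zero, dotProduct_zero, add_zero]
        positivity
      · have := hD.dotProduct_mulVec_pos ht
        rw [star_trivial] at this
        positivity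

/-- Elimination by the corner entry: `D` is the Schur complement of `a`, and the conjugating matrix
is unipotent, so determinant and positivity are read off the block diagonal middle factor. -/
theorem borderedMatrix_eq_transpose_mul_mul {a : ℝ} (ha : a ≠ 0) :
    borderedMatrix a b b (D + a⁻¹ • vecMulVec b b) =
      (borderedMatrix 1 (a⁻¹ • b) 0 1)ᵀ * borderedMatrix a 0 0 D *
        borderedMatrix 1 (a⁻¹ • b) 0 1 := by
  simp only [borderedMatrix_transpose, borderedMatrix_mul]
  congr 1
  · simp
  · simp [ha]
  · simp [ha]
  · ext i j
    simp [vecMulVec_apply, ha]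
    ring

theorem det_borderedMatrix_add {a : ℝ} (ha : a ≠ 0) :
    (borderedMatrix a b b (D + a⁻¹ • vecMulVec b b)).det = a * D.det := by
  rw [borderedMatrix_eq_transpose_mul_mul b D ha]
  simp [det_borderedMatrix_zero_right]

theorem posDef_borderedMatrix_add {a : ℝ} (ha : 0 < a) :
    (borderedMatrix a b b (D + a⁻¹ • vecMulVec b b)).PosDef ↔ D.PosDef := by
  have hU : IsUnit (borderedMatrix 1 (a⁻¹ • b) 0 1) := by
    rw [isUnit_iff_isUnit_det, det_borderedMatrix_zero_right]
    simp
  rw [borderedMatrix_eq_transpose_mul_mul b D ha.ne', ← conjTranspose_eq_transpose_of_trivial,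
    ← star_eq_conjTranspose, hU.posDef_star_left_conjugate_iff, posDef_borderedMatrix_zero_zero]
  simp [ha]

/-- Elimination in the opposite order: `s` is the Schur complement of the lower block `D`, and `w`
is `D⁻¹` applied to the first row. Decomposing `X` this way and `Y` by its corner makes the trace
pairing split into three separate terms. -/
theorem Matrix.PosDef.exists_eq_borderedMatrix {X : Matrix (Fin (m + 1)) (Fin (m + 1)) ℝ}
    (hX : X.PosDef) : ∃ (s : ℝ) (w : Fin m → ℝ) (D : Matrix (Fin m) (Fin m) ℝ), 0 < s ∧ D.PosDef ∧
      X = borderedMatrix (s + w ⬝ᵥ (D *ᵥ w)) (D *ᵥ w) (D *ᵥ w) D ∧ X.det = s * D.det := by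
  set D := X.submatrix Fin.succ Fin.succ with hDdef
  have hD : D.PosDef := hX.submatrix (Fin.succ_injective m)
  set b : Fin m → ℝ := fun j => X 0 j.succ with hb
  have hDu : IsUnit D.det := isUnit_iff_ne_zero.2 hD.det_pos.ne'
  set w := D⁻¹ *ᵥ b with hw
  have hDw : D *ᵥ w = b := by rw [hw, mulVec_mulVec, mul_nonsing_inv _ hDu, one_mulVec]
  have hDT : Dᵀ = D := by simpa using hD.1.eq
  have hwD : w ᵥ* D = b := by rw [← hDT, vecMul_transpose, hDw]
  have hcol : (fun i : Fin m => X i.succ 0) = b := by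
    ext i
    simpa using (hX.1.apply 0 i.succ)
  have hX1 : X = borderedMatrix ((X 0 0 - w ⬝ᵥ b) + w ⬝ᵥ (D *ᵥ w)) (D *ᵥ w) (D *ᵥ w) D := by
    conv_lhs => rw [eq_borderedMatrix X, hcol]
    rw [hDw, sub_add_cancel]
  have hX2 : X = (borderedMatrix 1 0 w 1)ᵀ * borderedMatrix (X 0 0 - w ⬝ᵥ b) 0 0 D *
      borderedMatrix 1 0 w 1 := by
    conv_lhs => rw [hX1]
    simp only [borderedMatrix_transpose, borderedMatrix_mul]
    congr 1
    · simp [hDw, hwD, dotProduct_comm]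
    · simp [hDw, hwD]
    · simp
    · ext i j
      simp
  have hU : IsUnit (borderedMatrix 1 0 w 1) := by
    rw [isUnit_iff_isUnit_det, det_borderedMatrix_zero_left]
    simp
  refine ⟨X 0 0 - w ⬝ᵥ b, w, D, ?_, hD, hX1, ?_⟩
  · rw [hX2, ← conjTranspose_eq_transpose_of_trivial, ← star_eq_conjTranspose,
      hU.posDef_star_left_conjugate_iff, posDef_borderedMatrix_zero_zero] at hX
    exact hX.1
  · conv_lhs => rw [hX2]
    simp [det_borderedMatrix_zero_left, det_borderedMatrix_zero_right, borderedMatrix_transpose]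

/-- The trace pairing of two bordered matrices, after completing the square. -/
theorem trace_borderedMatrix_mul {s a : ℝ} (ha : a ≠ 0) (w b : Fin m → ℝ)
    {X : Matrix (Fin m) (Fin m) ℝ} (hX : Xᵀ = X) (D : Matrix (Fin m) (Fin m) ℝ) :
    (borderedMatrix (s + w ⬝ᵥ (X *ᵥ w)) (X *ᵥ w) (X *ᵥ w) X *
      borderedMatrix a b b (D + a⁻¹ • vecMulVec b b)).trace =
      s * a + (b + a • w) ⬝ᵥ ((a⁻¹ • X) *ᵥ (b + a • w)) + (X * D).trace := by
  have hbw : b ⬝ᵥ (X *ᵥ w) = w ⬝ᵥ (X *ᵥ b) := by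
    rw [dotProduct_mulVec, ← hX, vecMul_transpose, hX, dotProduct_comm]
  have hbb : (X * vecMulVec b b).trace = b ⬝ᵥ (X *ᵥ b) := by
    rw [mul_vecMulVec, trace_vecMulVec, dotProduct_comm]
  rw [borderedMatrix_mul, trace_borderedMatrix]
  simp only [trace_add, trace_vecMulVec, Matrix.mul_add, Matrix.mul_smul, trace_smul, hbb,
    smul_eq_mul, smul_mulVec, mulVec_add, mulVec_smul, dotProduct_add, add_dotProduct,
    smul_dotProduct, dotProduct_smul, hbw, dotProduct_comm (X *ᵥ w) b]
  field_simp
  ring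

end Bordered

/-! ### Coordinates on symmetric matrices -/

section SymCoordinates

variable {m : ℕ}

theorem bijective_sym2_succ (m : ℕ) : Function.Bijective
    (Sum.elim (fun _ => s(0, 0)) (Sum.elim (fun i => s(0, i.succ)) (Sym2.map Fin.succ)) :
      Unit ⊕ (Fin m ⊕ Sym2 (Fin m)) → Sym2 (Fin (m + 1))) := by
  constructor
  · have h0 (p : Sym2 (Fin m)) (i : Fin (m + 1)) : Sym2.map Fin.succ p ≠ s(0, i) := by
      induction p with | _ x y =>
      intro h
      rw [Sym2.map_mk, Sym2.eq_iff] at h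
      rcases h with h | h
      · exact Fin.succ_ne_zero _ h.1
      · exact Fin.succ_ne_zero _ h.2
    rintro (_ | i | p) (_ | j | q) h
    · rfl
    · simp only [Sum.elim_inl, Sum.elim_inr, Sym2.eq_iff] at h
      simp [(Fin.succ_ne_zero j).symm] at h
    · exact absurd h.symm (h0 q 0)
    · simp only [Sum.elim_inl, Sum.elim_inr, Sym2.eq_iff] at h
      simp [Fin.succ_ne_zero i] at h
    · simp only [Sum.elim_inl, Sum.elim_inr, Sym2.eq_iff] at h
      simp [Fin.succ_ne_zero] at h
      simp [h]
    · exact absurd h.symm (h0 q _)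
    · exact absurd h (h0 p 0)
    · exact absurd h (h0 p _)
    · simp only [Sum.elim_inr] at h
      rw [Sym2.map.injective (Fin.succ_injective m) h]
  · intro p
    induction p with | _ x y =>
    refine Fin.cases ?_ (fun i => ?_) x <;> refine Fin.cases ?_ (fun j => ?_) y
    · exact ⟨.inl (), rfl⟩
    · exact ⟨.inr (.inl j), rfl⟩
    · exact ⟨.inr (.inl i), Sym2.eq_swap⟩
    · exact ⟨.inr (.inr s(i, j)), rfl⟩

/-- An unordered pair in `Fin (m + 1)` is `{0, 0}`, or `{0, i + 1}`, or a shifted unordered pair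
in `Fin m`. -/
noncomputable def sym2SuccEquiv (m : ℕ) : Unit ⊕ (Fin m ⊕ Sym2 (Fin m)) ≃ Sym2 (Fin (m + 1)) :=
  Equiv.ofBijective _ (bijective_sym2_succ m)

/-- The coordinates of the bordered symmetric matrix with corner entry `a`, first row and column
`b`, and remaining block with coordinates `y`. -/
noncomputable def symCons (p : (Unit → ℝ) × ((Fin m → ℝ) × (Sym2 (Fin m) → ℝ))) :
    Sym2 (Fin (m + 1)) → ℝ :=
  MeasurableEquiv.piCongrLeft (fun _ => ℝ) (sym2SuccEquiv m)
    ((MeasurableEquiv.sumPiEquivProdPi fun _ => ℝ).symm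
      (p.1, (MeasurableEquiv.sumPiEquivProdPi fun _ => ℝ).symm p.2))

theorem measurePreserving_symCons :
    MeasurePreserving (symCons (m := m)) :=
  (volume_measurePreserving_piCongrLeft (fun _ => ℝ) (sym2SuccEquiv m)).comp <|
    (volume_measurePreserving_sumPiEquivProdPi_symm fun _ => ℝ).comp <|
      (MeasurePreserving.id volume).prod
        (volume_measurePreserving_sumPiEquivProdPi_symm fun _ => ℝ)

theorem symCons_apply (p : (Unit → ℝ) × ((Fin m → ℝ) × (Sym2 (Fin m) → ℝ)))
    (i : Unit ⊕ (Fin m ⊕ Sym2 (Fin m))) :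
    symCons p (sym2SuccEquiv m i) = Sum.elim p.1 (Sum.elim p.2.1 p.2.2) i := by
  rw [symCons, MeasurableEquiv.coe_piCongrLeft, Equiv.piCongrLeft_apply_apply]
  rcases i with i | i | i <;> rfl

theorem symMatrix_symCons (a : ℝ) (b : Fin m → ℝ) (y : Sym2 (Fin m) → ℝ) :
    symMatrix (m + 1) (symCons (fun _ => a, b, y)) = borderedMatrix a b b (symMatrix m y) := by
  ext i j
  refine Fin.cases ?_ (fun i => ?_) i <;> refine Fin.cases ?_ (fun j => ?_) j
  · exact symCons_apply _ (.inl ())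
  · exact symCons_apply _ (.inr (.inl j))
  · simp only [symMatrix, of_apply]
    rw [Sym2.eq_swap]
    exact symCons_apply _ (.inr (.inl i))
  · exact symCons_apply _ (.inr (.inr s(i, j)))

/-- Tonelli for the measure-preserving splitting into corner, first row and remaining block. -/
theorem lintegral_sym2_succ {f : (Sym2 (Fin (m + 1)) → ℝ) → ENNReal} (hf : Measurable f) :
    ∫⁻ y, f y = ∫⁻ a : ℝ, ∫⁻ b : Fin m → ℝ, ∫⁻ y : Sym2 (Fin m) → ℝ,
      f (symCons (fun _ => a, b, y)) := by
  have hmp := measurePreserving_symCons (m := m)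
  have hg : Measurable fun p => f (symCons p) := hf.comp hmp.measurable
  rw [← hmp.lintegral_comp hf, Measure.volume_eq_prod, lintegral_prod _ hg.aemeasurable,
    ← (volume_preserving_funUnique Unit ℝ).symm.lintegral_comp hg.lintegral_prod_right']
  refine lintegral_congr fun a => ?_
  have hga : Measurable fun p => f (symCons (fun _ => a, p)) := hg.comp measurable_prodMk_left
  exact lintegral_prod _ hga.aemeasurable

theorem continuous_symMatrix (m : ℕ) : Continuous (symMatrix m) := by
  refine continuous_matrix fun i j => ?_
  exact continuous_apply s(i, j)

theorem symMatrix_isHermitian (y : Sym2 (Fin m) → ℝ) : (symMatrix m y).IsHermitian := by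
  ext i j
  simp [symMatrix, Sym2.eq_swap]

theorem measurableSet_posDef_symMatrix (m : ℕ) :
    MeasurableSet {y : Sym2 (Fin m) → ℝ | (symMatrix m y).PosDef} :=
  (isOpen_setOf_posDef (continuous_symMatrix m) symMatrix_isHermitian).measurableSet

/-- In coordinates, passing to the Schur complement is a translation, so it preserves Lebesgue
measure. -/
theorem symMatrix_add_mul (y : Sym2 (Fin m) → ℝ) (c : ℝ) (b : Fin m → ℝ) :
    symMatrix m (y + fun p => c * (p.map b).mul) = symMatrix m y + c • vecMulVec b b := by
  ext i j
  simp [symMatrix, vecMulVec_apply]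

end SymCoordinates

/-! ### The matrix Gamma integral -/

section GammaIntegral

open Real

variable {m : ℕ}

/-- The integrand of the matrix Gamma integral over the positive definite cone. -/
noncomputable def matrixGammaIntegrand (m : ℕ) (α : ℝ) (X Y : Matrix (Fin m) (Fin m) ℝ) : ℝ :=
  {Y : Matrix (Fin m) (Fin m) ℝ | Y.PosDef}.indicator
    (fun Y => Y.det ^ (α - ((m : ℝ) + 1) / 2) * exp (-(X * Y).trace)) Y

theorem measurable_matrixGammaIntegrand_symMatrix (α : ℝ) (X : Matrix (Fin m) (Fin m) ℝ) :
    Measurable fun y => matrixGammaIntegrand m α X (symMatrix m y) := by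
  have hs : Continuous (symMatrix m) := continuous_symMatrix m
  have h1 : Measurable fun y : Sym2 (Fin m) → ℝ => (symMatrix m y).det :=
    hs.matrix_det.measurable
  have h2 : Measurable fun y : Sym2 (Fin m) → ℝ => (X * symMatrix m y).trace :=
    (continuous_const.matrix_mul hs).matrix_trace.measurable
  exact ((h1.pow_const _).mul h2.neg.exp).indicator (measurableSet_posDef_symMatrix m)

theorem matrixGammaIntegrand_borderedMatrix_of_nonpos (α : ℝ) {a : ℝ} (ha : a ≤ 0)
    (b : Fin m → ℝ) (D : Matrix (Fin m) (Fin m) ℝ) (X : Matrix (Fin (m + 1)) (Fin (m + 1)) ℝ) :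
    matrixGammaIntegrand (m + 1) α X (borderedMatrix a b b D) = 0 := by
  refine Set.indicator_of_notMem (fun h => ?_) _
  exact ha.not_gt (PosDef.diag_pos (A := borderedMatrix a b b D) h (i := 0))

/-- The determinant is `a * det D`, and its exponent `α - (m+2)/2` is exactly the one belonging to
size `m` and parameter `α - 1/2`, which is what drives the induction. -/
theorem matrixGammaIntegrand_borderedMatrix (α : ℝ) {s a : ℝ} (ha : 0 < a) (w b : Fin m → ℝ)
    {X : Matrix (Fin m) (Fin m) ℝ} (hX : Xᵀ = X) (D : Matrix (Fin m) (Fin m) ℝ) :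
    matrixGammaIntegrand (m + 1) α
      (borderedMatrix (s + w ⬝ᵥ (X *ᵥ w)) (X *ᵥ w) (X *ᵥ w) X)
      (borderedMatrix a b b (D + a⁻¹ • vecMulVec b b)) =
    a ^ (α - (m + 2) / 2) * exp (-(s * a)) *
      exp (-((b + a • w) ⬝ᵥ ((a⁻¹ • X) *ᵥ (b + a • w)))) *
        matrixGammaIntegrand m (α - 1 / 2) X D := by
  by_cases hD : D.PosDef
  · have hY := (posDef_borderedMatrix_add b D ha).2 hD
    rw [matrixGammaIntegrand, Set.indicator_of_mem (by exact hY), matrixGammaIntegrand,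
      Set.indicator_of_mem (by exact hD), det_borderedMatrix_add b D ha.ne',
      trace_borderedMatrix_mul ha.ne' w b hX, mul_rpow ha.le hD.det_pos.le, neg_add, neg_add,
      exp_add, exp_add]
    have e1 : α - ((((m + 1 : ℕ) : ℝ)) + 1) / 2 = α - (m + 2) / 2 := by push_cast; ring
    have e2 : α - 1 / 2 - ((m : ℝ) + 1) / 2 = α - (m + 2) / 2 := by ring
    rw [e1, e2]
    ring
  · have hY := mt (posDef_borderedMatrix_add b D ha).1 hD
    rw [matrixGammaIntegrand, Set.indicator_of_notMem (by exact hY), matrixGammaIntegrand,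
      Set.indicator_of_notMem (by exact hD), mul_zero]

/-- The matrix Gamma integral. -/
theorem lintegral_matrixGammaIntegrand (m : ℕ) {α : ℝ} (hα : ((m : ℝ) - 1) / 2 < α)
    {X : Matrix (Fin m) (Fin m) ℝ} (hX : X.PosDef) :
    ∫⁻ y, ENNReal.ofReal (matrixGammaIntegrand m α X (symMatrix m y)) =
      ENNReal.ofReal ((π ^ ((m : ℝ) * ((m : ℝ) - 1) / 4) *
        ∏ j ∈ Finset.range m, Gamma (α - (j : ℝ) / 2)) * X.det ^ (-α)) := by
  induction m generalizing α with
  | zero =>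
    have hv : (volume : Measure (Sym2 (Fin 0) → ℝ)) Set.univ = 1 := by
      rw [volume_pi, Measure.pi_empty_univ]
    have hval (Y : Matrix (Fin 0) (Fin 0) ℝ) : matrixGammaIntegrand 0 α X Y = 1 := by
      rw [matrixGammaIntegrand, Set.indicator_of_mem]
      · simp [trace]
      · rw [Subsingleton.elim Y 1]
        exact PosDef.one
    simp [hval, hv]
  | succ m ih =>
    have hm : (0 : ℝ) ≤ m := Nat.cast_nonneg m
    push_cast at hα
    have hα0 : 0 < α := by linarith
    obtain ⟨s, w, X', hs, hX', rfl, hdet⟩ := hX.exists_eq_borderedMatrix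
    set X := borderedMatrix (s + w ⬝ᵥ (X' *ᵥ w)) (X' *ᵥ w) (X' *ᵥ w) X' with hXdef
    have hXT : X'ᵀ = X' := hX'.1
    have hd := hX'.det_pos
    set K : ℝ := (π ^ ((m : ℝ) * ((m : ℝ) - 1) / 4) *
        ∏ j ∈ Finset.range m, Gamma (α - 1 / 2 - (j : ℝ) / 2)) with hK
    have hK0 : 0 < K := by
      refine mul_pos (by positivity) (Finset.prod_pos fun j hj => Gamma_pos_of_pos ?_)
      have : (j : ℝ) + 1 ≤ m := by exact_mod_cast Finset.mem_range.1 hj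
      linarith
    have hin (a : ℝ) (ha : 0 < a) (b : Fin m → ℝ) :
        ∫⁻ y, ENNReal.ofReal (matrixGammaIntegrand (m + 1) α X
          (symMatrix (m + 1) (symCons (fun _ => a, b, y)))) =
        ENNReal.ofReal (exp (-((b + a • w) ⬝ᵥ ((a⁻¹ • X') *ᵥ (b + a • w))))) *
          ENNReal.ofReal (a ^ (α - (m + 2) / 2) * exp (-(s * a)) *
            (K * X'.det ^ (-(α - 1 / 2)))) := by
      simp_rw [symMatrix_symCons]
      -- Translate the lower block by `a⁻¹ b bᵀ`, so that the integration variable becomes the Schur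
      -- complement.
      rw [← lintegral_add_right_eq_self _ (fun p : Sym2 (Fin m) => a⁻¹ * (p.map b).mul)]
      simp_rw [symMatrix_add_mul, hXdef, matrixGammaIntegrand_borderedMatrix α ha w b hXT]
      have h0 : 0 ≤ a ^ (α - ((m : ℝ) + 2) / 2) * exp (-(s * a)) := by positivity
      simp_rw [ENNReal.ofReal_mul (mul_nonneg h0 (exp_pos _).le)]
      rw [lintegral_const_mul _
        (measurable_matrixGammaIntegrand_symMatrix _ _).ennreal_ofReal, ih (by linarith) hX',
        ENNReal.ofReal_mul h0, ENNReal.ofReal_mul h0, ← hK]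
      ring
    have hmid (a : ℝ) (ha : 0 < a) :
        ∫⁻ b : Fin m → ℝ, ∫⁻ y, ENNReal.ofReal (matrixGammaIntegrand (m + 1) α X
          (symMatrix (m + 1) (symCons (fun _ => a, b, y)))) =
        ENNReal.ofReal (π ^ ((m : ℝ) / 2) * K * X'.det ^ (-α)) *
          ENNReal.ofReal (a ^ (α - 1) * exp (-(s * a))) := by
      have hm1 : Measurable fun b : Fin m → ℝ =>
          ENNReal.ofReal (exp (-((b + a • w) ⬝ᵥ ((a⁻¹ • X') *ᵥ (b + a • w))))) := by
        have h1 : Continuous fun b : Fin m → ℝ => b + a • w := by fun_prop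
        exact ((h1.dotProduct (continuous_const.matrix_mulVec h1)).neg.rexp).measurable.ennreal_ofReal
      simp_rw [hin a ha]
      -- Translation by `a • w` centers the Gaussian in `b`.
      rw [lintegral_mul_const _ hm1, lintegral_add_right_eq_self
        (fun b : Fin m → ℝ => ENNReal.ofReal (exp (-(b ⬝ᵥ ((a⁻¹ • X') *ᵥ b))))),
        lintegral_exp_neg_dotProduct_mulVec (hX'.smul (inv_pos.2 ha)),
        ← ENNReal.ofReal_mul (by have := (hX'.smul (inv_pos.2 ha)).det_pos; positivity),
        ← ENNReal.ofReal_mul (by positivity)]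
      congr 1
      rw [det_smul, Fintype.card_fin, mul_rpow (by positivity) hd.le, inv_pow,
        inv_rpow (by positivity), ← rpow_neg (by positivity), neg_neg, ← rpow_natCast a m,
        ← rpow_mul ha.le]
      -- The Gaussian with matrix `a⁻¹ X'` contributes `a^(m/2)`, which restores the scalar Gamma
      -- exponent `α - 1`.
      have e1 : a ^ (α - 1) = a ^ ((m : ℝ) * (1 / 2)) * a ^ (α - (m + 2) / 2) := by
        rw [← rpow_add ha]
        congr 1
        ring
      have e2 : X'.det ^ (-α) = X'.det ^ (-(1 / 2) : ℝ) * X'.det ^ (-(α - 1 / 2)) := by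
        rw [← rpow_add hd]
        congr 1
        ring
      rw [e1, e2]
      ring
    have hout (a : ℝ) :
        ∫⁻ b : Fin m → ℝ, ∫⁻ y, ENNReal.ofReal (matrixGammaIntegrand (m + 1) α X
          (symMatrix (m + 1) (symCons (fun _ => a, b, y)))) =
        (Set.Ioi 0).indicator (fun a => ENNReal.ofReal (π ^ ((m : ℝ) / 2) * K * X'.det ^ (-α)) *
          ENNReal.ofReal (a ^ (α - 1) * exp (-(s * a)))) a := by
      by_cases ha : 0 < a
      · rw [Set.indicator_of_mem (by exact ha), hmid a ha]
      · rw [Set.indicator_of_notMem (by exact ha)]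
        simp [symMatrix_symCons, matrixGammaIntegrand_borderedMatrix_of_nonpos α (not_lt.1 ha)]
    rw [lintegral_sym2_succ (measurable_matrixGammaIntegrand_symMatrix _ _).ennreal_ofReal]
    simp_rw [hout]
    rw [lintegral_indicator measurableSet_Ioi, lintegral_const_mul _ (by fun_prop),
      lintegral_rpow_mul_exp_neg_mul hα0 hs, ← ENNReal.ofReal_mul (by positivity)]
    congr 1
    -- The new scalar factor `Γ(α)` is the `j = 0` term; the induction hypothesis at `α - 1/2`
    -- supplies the others with `j` shifted by one.
    rw [hdet, mul_rpow hs.le hd.le, Finset.prod_range_succ', hK]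
    have e1 : π ^ (((m + 1 : ℕ) : ℝ) * (((m + 1 : ℕ) : ℝ) - 1) / 4) =
        π ^ ((m : ℝ) * ((m : ℝ) - 1) / 4) * π ^ ((m : ℝ) / 2) := by
      rw [← rpow_add pi_pos]
      congr 1
      push_cast
      ring
    have e2 (j : ℕ) : α - ((j + 1 : ℕ) : ℝ) / 2 = α - 1 / 2 - (j : ℝ) / 2 := by
      push_cast
      ring
    simp_rw [e1, e2]
    simp
    ring

end GammaIntegral

/-! ### The Gaussian integral over rectangular matrices -/

section SingularIntegral

open Real

/-- Adjoining a column `z` adds `z zᵀ` to `Z Zᵀ`, so the exponential factors over columns. -/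
theorem trace_mul_mul_transpose_consColumn {m r : ℕ} (X : Matrix (Fin m) (Fin m) ℝ)
    (z : Fin m → ℝ) (Z : Fin m → Fin r → ℝ) :
    (X * ((Matrix.of fun i => (Fin.cons (z i) (Z i) : Fin (r + 1) → ℝ)) *
      (Matrix.of fun i => (Fin.cons (z i) (Z i) : Fin (r + 1) → ℝ))ᵀ)).trace =
      z ⬝ᵥ (X *ᵥ z) + (X * (Matrix.of Z * (Matrix.of Z)ᵀ)).trace := by
  have h : (Matrix.of fun i => (Fin.cons (z i) (Z i) : Fin (r + 1) → ℝ)) *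
      (Matrix.of fun i => (Fin.cons (z i) (Z i) : Fin (r + 1) → ℝ))ᵀ =
      vecMulVec z z + Matrix.of Z * (Matrix.of Z)ᵀ := by
    ext i j
    simp [mul_apply, Fin.sum_univ_succ, vecMulVec_apply]
  rw [h, Matrix.mul_add, trace_add, mul_vecMulVec, trace_vecMulVec, dotProduct_comm]

theorem measurePreserving_consColumn (m r : ℕ) :
    MeasurePreserving fun (p : (Fin m → ℝ) × (Fin m → Fin r → ℝ)) (i : Fin m) =>
      (Fin.cons (p.1 i) (p.2 i) : Fin (r + 1) → ℝ) := by
  have h1 := (volume_measurePreserving_arrowProdEquivProdArrow ℝ (Fin r → ℝ) (Fin m)).symm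
  have h2 := volume_preserving_pi (ι := Fin m) (fun _ =>
    (volume_preserving_piFinSuccAbove (fun _ : Fin (r + 1) => ℝ) 0).symm)
  convert! h2.comp h1 using 1
  ext p i k
  simp [MeasurableEquiv.piFinSuccAbove, MeasurableEquiv.arrowProdEquivProdArrow,
    Equiv.arrowProdEquivProdArrow]

theorem measurable_exp_trace_mul_transpose {m r : ℕ} (X : Matrix (Fin m) (Fin m) ℝ) :
    Measurable fun Z : Fin m → Fin r → ℝ =>
      ENNReal.ofReal (exp (-(X * (Matrix.of Z * (Matrix.of Z)ᵀ)).trace)) := by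
  have hZ : Continuous fun Z : Fin m → Fin r → ℝ => Matrix.of Z := continuous_id
  exact ((continuous_const.matrix_mul
    (hZ.matrix_mul hZ.matrix_transpose)).matrix_trace.neg.rexp).measurable.ennreal_ofReal

theorem lintegral_exp_neg_trace_mul_transpose {m : ℕ} (r : ℕ) {X : Matrix (Fin m) (Fin m) ℝ}
    (hX : X.PosDef) :
    ∫⁻ Z : Fin m → Fin r → ℝ,
      ENNReal.ofReal (exp (-(X * (Matrix.of Z * (Matrix.of Z)ᵀ)).trace)) =
      ENNReal.ofReal (π ^ ((m : ℝ) * (r : ℝ) / 2) * X.det ^ (-((r : ℝ) / 2))) := by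
  have hd := hX.det_pos
  induction r with
  | zero =>
    have hv : (volume : Measure (Fin m → Fin 0 → ℝ)) Set.univ = 1 := by
      rw [volume_pi, Measure.pi_univ]
      refine Finset.prod_eq_one fun i _ => ?_
      rw [volume_pi, Measure.pi_empty_univ]
    simp [hv]
  | succ r ih =>
    rw [← (measurePreserving_consColumn m r).lintegral_comp
      (measurable_exp_trace_mul_transpose X)]
    simp_rw [trace_mul_mul_transpose_consColumn, neg_add, exp_add,
      ENNReal.ofReal_mul (exp_pos _).le]
    have hm1 : Measurable fun b : Fin m → ℝ => ENNReal.ofReal (exp (-(b ⬝ᵥ (X *ᵥ b)))) := by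
      have h1 : Continuous fun b : Fin m → ℝ => b := continuous_id
      exact ((h1.dotProduct (continuous_const.matrix_mulVec h1)).neg.rexp).measurable.ennreal_ofReal
    rw [Measure.volume_eq_prod, lintegral_prod_mul hm1.aemeasurable
      (measurable_exp_trace_mul_transpose X).aemeasurable, ih,
      lintegral_exp_neg_dotProduct_mulVec hX, Fintype.card_fin,
      ← ENNReal.ofReal_mul (by positivity)]
    congr 1
    have e1 : π ^ ((m : ℝ) * ((r + 1 : ℕ) : ℝ) / 2) =
        π ^ ((m : ℝ) / 2) * π ^ ((m : ℝ) * (r : ℝ) / 2) := by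
      rw [← rpow_add pi_pos]
      congr 1
      push_cast
      ring
    have e2 : X.det ^ (-(((r + 1 : ℕ) : ℝ) / 2)) =
        X.det ^ (-(1 / 2) : ℝ) * X.det ^ (-((r : ℝ) / 2)) := by
      rw [← rpow_add hd]
      congr 1
      push_cast
      ring
    rw [e1, e2]
    ring

end SingularIntegral

/-! ### Laplace transform and support of the explicit measures -/

section RieszMeasure

open Real

variable {m : ℕ}

theorem detRieszKernel_mul_exp (α : ℝ) (X Y : Matrix (Fin m) (Fin m) ℝ) :
    detRieszKernel m α Y * exp (-(X * Y).trace) =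
      (π ^ ((m : ℝ) * ((m : ℝ) - 1) / 4) *
        ∏ j ∈ Finset.range m, Gamma (α - (j : ℝ) / 2))⁻¹ * matrixGammaIntegrand m α X Y := by
  by_cases hY : Y.PosDef
  · rw [detRieszKernel, matrixGammaIntegrand, Set.indicator_of_mem (by exact hY),
      Set.indicator_of_mem (by exact hY)]
    ring
  · rw [detRieszKernel, matrixGammaIntegrand, Set.indicator_of_notMem (by exact hY),
      Set.indicator_of_notMem (by exact hY)]
    ring

theorem measurable_detRieszKernel_symMatrix (α : ℝ) :
    Measurable fun y => ENNReal.ofReal (detRieszKernel m α (symMatrix m y)) := by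
  have h1 : Measurable fun y : Sym2 (Fin m) → ℝ => (symMatrix m y).det :=
    (continuous_symMatrix m).matrix_det.measurable
  exact (((h1.pow_const _).const_mul _).indicator
    (measurableSet_posDef_symMatrix m)).ennreal_ofReal

theorem continuous_mul_transpose_of (m r : ℕ) :
    Continuous fun Z : Fin m → Fin r → ℝ => Matrix.of Z * (Matrix.of Z)ᵀ := by
  have hZ : Continuous fun Z : Fin m → Fin r → ℝ => Matrix.of Z := continuous_id
  exact hZ.matrix_mul hZ.matrix_transpose

theorem measurable_exp_neg_trace_mul (X : Matrix (Fin m) (Fin m) ℝ) :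
    Measurable fun Y : Matrix (Fin m) (Fin m) ℝ => ENNReal.ofReal (exp (-(X * Y).trace)) := by
  have : Continuous fun Y : Matrix (Fin m) (Fin m) ℝ => exp (-(X * Y).trace) :=
    (continuous_const.matrix_mul continuous_id).matrix_trace.neg.rexp
  exact this.measurable.ennreal_ofReal

theorem lintegral_exp_wishartDensityMeasure {α : ℝ} (hα : ((m : ℝ) - 1) / 2 < α)
    {X : Matrix (Fin m) (Fin m) ℝ} (hX : X.PosDef) :
    ∫⁻ Y, ENNReal.ofReal (exp (-(X * Y).trace)) ∂wishartDensityMeasure m α =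
      ENNReal.ofReal (X.det ^ (-α)) := by
  have hc : 0 < π ^ ((m : ℝ) * ((m : ℝ) - 1) / 4) *
      ∏ j ∈ Finset.range m, Gamma (α - (j : ℝ) / 2) := by
    refine mul_pos (by positivity) (Finset.prod_pos fun j hj => Gamma_pos_of_pos ?_)
    have : (j : ℝ) + 1 ≤ m := by exact_mod_cast Finset.mem_range.1 hj
    linarith
  have hs : Measurable (symMatrix m) := (continuous_symMatrix m).measurable
  have hexp : Measurable fun y => ENNReal.ofReal (exp (-(X * symMatrix m y).trace)) :=
    (measurable_exp_neg_trace_mul X).comp hs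
  rw [wishartDensityMeasure, lintegral_map (measurable_exp_neg_trace_mul X) hs,
    lintegral_withDensity_eq_lintegral_mul _ (measurable_detRieszKernel_symMatrix α) hexp]
  simp only [Pi.mul_apply, ← ENNReal.ofReal_mul' (exp_pos _).le, detRieszKernel_mul_exp,
    ENNReal.ofReal_mul (inv_pos.2 hc).le]
  rw [lintegral_const_mul _ (measurable_matrixGammaIntegrand_symMatrix α X).ennreal_ofReal,
    lintegral_matrixGammaIntegrand m hα hX, ← ENNReal.ofReal_mul (inv_pos.2 hc).le,
    inv_mul_cancel_left₀ hc.ne']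

theorem lintegral_exp_wishartSingularMeasure (r : ℕ) {X : Matrix (Fin m) (Fin m) ℝ}
    (hX : X.PosDef) :
    ∫⁻ Y, ENNReal.ofReal (exp (-(X * Y).trace)) ∂wishartSingularMeasure m r =
      ENNReal.ofReal (X.det ^ (-((r : ℝ) / 2))) := by
  rw [wishartSingularMeasure, lintegral_smul_measure, lintegral_map (measurable_exp_neg_trace_mul X)
    (continuous_mul_transpose_of m r).measurable, lintegral_exp_neg_trace_mul_transpose r hX,
    smul_eq_mul, ← ENNReal.ofReal_mul (by positivity), rpow_neg pi_pos.le,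
    inv_mul_cancel_left₀ (by positivity)]

theorem wishartDensityMeasure_apply_eq_zero (α : ℝ) {S : Set (Matrix (Fin m) (Fin m) ℝ)}
    (hS : MeasurableSet S) (h : ∀ Y ∈ S, ¬ Y.PosSemidef) : wishartDensityMeasure m α S = 0 := by
  have hs : Measurable (symMatrix m) := (continuous_symMatrix m).measurable
  rw [wishartDensityMeasure, Measure.map_apply hs hS, withDensity_apply _ (hs hS)]
  refine setLIntegral_eq_zero (hs hS) fun y hy => ?_
  have : ¬ (symMatrix m y).PosDef := fun hp => h _ hy hp.posSemidef
  simp [detRieszKernel, this]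

theorem wishartSingularMeasure_apply_eq_zero (r : ℕ) {S : Set (Matrix (Fin m) (Fin m) ℝ)}
    (hS : MeasurableSet S) (h : ∀ Y ∈ S, ¬ Y.PosSemidef) : wishartSingularMeasure m r S = 0 := by
  have hpre : (fun Z : Fin m → Fin r → ℝ => Matrix.of Z * (Matrix.of Z)ᵀ) ⁻¹' S = ∅ := by
    refine Set.eq_empty_of_forall_notMem fun Z hZ => h _ hZ ?_
    simpa using posSemidef_self_mul_conjTranspose (Matrix.of Z)
  rw [wishartSingularMeasure, Measure.smul_apply,
    Measure.map_apply (continuous_mul_transpose_of m r).measurable hS, hpre]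
  simp

/-- As `r ≤ m - 1`, the density case does not apply, and the floor of `2 * α` recovers `r`. -/
theorem detRieszMeasure_half {r : ℕ} (hr : r < m) :
    detRieszMeasure m ((r : ℝ) / 2) = wishartSingularMeasure m r := by
  have h1 : (r : ℝ) + 1 ≤ m := by exact_mod_cast hr
  rw [detRieszMeasure, if_neg (by linarith), mul_div_cancel₀ _ two_ne_zero, Nat.floor_natCast]

theorem lintegral_exp_detRieszMeasure {α : ℝ}
    (hα : (∃ r : ℕ, r < m ∧ α = (r : ℝ) / 2) ∨ ((m : ℝ) - 1) / 2 < α)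
    {X : Matrix (Fin m) (Fin m) ℝ} (hX : X.PosDef) :
    ∫⁻ Y, ENNReal.ofReal (exp (-(X * Y).trace)) ∂detRieszMeasure m α =
      ENNReal.ofReal (X.det ^ (-α)) := by
  rcases hα with ⟨r, hr, rfl⟩ | hα
  · rw [detRieszMeasure_half hr, lintegral_exp_wishartSingularMeasure r hX]
  · rw [detRieszMeasure, if_pos hα, lintegral_exp_wishartDensityMeasure hα hX]

theorem detRieszMeasure_apply_eq_zero (α : ℝ) {S : Set (Matrix (Fin m) (Fin m) ℝ)}
    (hS : MeasurableSet S) (h : ∀ Y ∈ S, ¬ Y.PosSemidef) : detRieszMeasure m α S = 0 := by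
  rw [detRieszMeasure]
  split_ifs
  · exact wishartDensityMeasure_apply_eq_zero α hS h
  · exact wishartSingularMeasure_apply_eq_zero _ hS h

end RieszMeasure

/-! ### Push-forward along the pencil -/

section Pencil

variable {m n : ℕ} (A : Fin n → Matrix (Fin m) (Fin m) ℝ)

theorem pencil_isHermitian (hA : ∀ i, (A i).IsSymm) (x : Fin n → ℝ) :
    (pencil A x).IsHermitian := by
  rw [IsHermitian, conjTranspose_eq_transpose_of_trivial]
  simp [pencil, transpose_sum, (hA _).eq]

theorem isOpen_spectrahedralCone (hA : ∀ i, (A i).IsSymm) : IsOpen (spectrahedralCone A) :=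
  isOpen_setOf_posDef (pencil A).continuous_of_finiteDimensional (pencil_isHermitian A hA)

theorem contDiff_det_pencil : ContDiff ℝ ∞ fun x => (pencil A x).det := by
  have h (i j : Fin m) : ContDiff ℝ ∞ fun x => pencil A x i j := by
    simp only [pencil, LinearMap.coe_mk, AddHom.coe_mk, Matrix.sum_apply, Matrix.smul_apply]
    fun_prop
  simp only [det_apply]
  exact ContDiff.sum fun σ _ => (contDiff_prod fun i _ => h _ _).const_smul _

theorem measurable_dualPencil : Measurable (dualPencil A) :=
  (dualPencil A).continuous_of_finiteDimensional.measurable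

theorem isClosed_closedDualCone {V : Type*} [NormedAddCommGroup V] [NormedSpace ℝ V]
    (C : Set V) : IsClosed (closedDualCone C) := by
  have : closedDualCone C = ⋂ x ∈ C, {y : StrongDual ℝ V | 0 ≤ y x} := by
    ext y
    simp [closedDualCone]
  rw [this]
  exact isClosed_biInter fun x _ =>
    isClosed_le continuous_const (ContinuousLinearMap.apply ℝ ℝ x).continuous

theorem isRieszMeasure_map_dualPencil {α : ℝ}
    (hα : (∃ r : ℕ, r < m ∧ α = (r : ℝ) / 2) ∨ ((m : ℝ) - 1) / 2 < α) :
    IsRieszMeasure (fun x : Fin n → ℝ => (pencil A x).det ^ (-α)) (spectrahedralCone A)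
      (Measure.map (dualPencil A) (detRieszMeasure m α)) := by
  have hL := measurable_dualPencil A
  constructor
  · have hmeas := (isClosed_closedDualCone (spectrahedralCone A)).measurableSet.compl
    rw [Measure.map_apply hL hmeas]
    exact detRieszMeasure_apply_eq_zero α (hL hmeas) fun Y hY hp =>
      hY fun x hx => PosDef.trace_mul_nonneg hx hp
  · intro x hx
    have hdet : 0 < (pencil A x).det := PosDef.det_pos hx
    have hm : Measurable fun y : StrongDual ℝ (Fin n → ℝ) => Real.exp (-(y x)) :=
      (measurable_dual_apply x).neg.exp
    have hlint : ∫⁻ y : StrongDual ℝ (Fin n → ℝ), ENNReal.ofReal (Real.exp (-(y x)))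
        ∂Measure.map (dualPencil A) (detRieszMeasure m α) =
        ENNReal.ofReal ((pencil A x).det ^ (-α)) := by
      rw [lintegral_map hm.ennreal_ofReal hL]
      exact lintegral_exp_detRieszMeasure hα hx
    have hpos : 0 ≤ᵐ[Measure.map (dualPencil A) (detRieszMeasure m α)]
        fun y : StrongDual ℝ (Fin n → ℝ) => Real.exp (-(y x)) :=
      .of_forall fun y => (Real.exp_pos _).le
    constructor
    -- The integrand is nonnegative, so finiteness of the lower integral already gives convergence
    -- of the Laplace transform.
    · refine ⟨hm.aestronglyMeasurable, ?_⟩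
      rw [hasFiniteIntegral_iff_ofReal hpos, hlint]
      exact ENNReal.ofReal_lt_top
    · rw [integral_eq_lintegral_of_nonneg_ae hpos hm.aestronglyMeasurable, hlint,
        ENNReal.toReal_ofReal (by positivity)]

end Pencil

theorem corollary4p2 (m n : ℕ) (A : Fin n → Matrix (Fin m) (Fin m) ℝ)
    (hsymm : ∀ i, (A i).IsSymm) (hindep : LinearIndependent ℝ A)
    (hne : (spectrahedralCone A).Nonempty) (α : ℝ)
    (hα : (∃ r : ℕ, r < m ∧ α = (r : ℝ) / 2) ∨ ((m : ℝ) - 1) / 2 < α) :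
    CompletelyMonotoneOn (fun x : Fin n → ℝ => (pencil A x).det ^ (-α)) (spectrahedralCone A) ∧
      ∀ μ : Measure (StrongDual ℝ (Fin n → ℝ)),
        IsRieszMeasure (fun x : Fin n → ℝ => (pencil A x).det ^ (-α)) (spectrahedralCone A) μ ↔
          μ = Measure.map (dualPencil A) (detRieszMeasure m α) := by
  have hopen := isOpen_spectrahedralCone A hsymm
  have hR := isRieszMeasure_map_dualPencil A hα
  refine ⟨hR.completelyMonotoneOn hopen ?_, fun μ => ⟨fun hμ => hμ.unique hopen hne hR, ?_⟩⟩
  · exact (contDiff_det_pencil A).contDiffOn.rpow_const_of_ne fun x hx => (PosDef.det_pos hx).ne'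
  · rintro rfl
    exact hR
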